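/- Let $\mathcal M$ be a unital $C^*$-algebra, $\mathcal B\subseteq\mathcal M$ a unital $C^*$-subalgebra, and $E\colon\mathcal M\to\mathcal B$ a (positive) conditional expectation, i.e. a positive linear map with $E(b)=b$ and $E(b_1Ab_2)=b_1E(A)b_2$ for all $b,b_1,b_2\in\mathcal B$, $A\in\mathcal M$. Let $\eta\colon\mathcal B\to\mathcal B$ be completely positive, and let $S=S^*\in\mathcal M$ be a centred $\mathcal B$-valued semicircular element with variance $\eta$: for all $n\ge 0$ and $b_1,\dots,b_n\in\mathcal B$, $E[Sb_1Sb_2\cdots Sb_n]$ is the sum over all noncrossing pair partitions of the $n$ letters $S$ of the corresponding nested evaluations of $\eta$ (equivalently, the only non-zero $\mathcal B$-valued free cumulant of $S$ is the second one, which is $\eta$; in particular $E[S]=0$ and $E[SbS]=\eta(b)$). Let $D=D^*\in\mathcal M$ be free from $S$ with amalgamation over $\mathcal B$ with respect to $E$. For $b\in\mathcal B$ write $\Im b=(b-b^*)/(2i)$, and let $\mathbb H^+(\mathcal B)=\{b\in\mathcal B:\Im b>0\}$, where $\Im b>0$ means that the spectrum of $\Im b$ is contained in $(0,\infty)$. Let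 $\omega$ be the subordination function $$\omega(b)=b-\eta\left(E\left[(b-S-D)^{-1}\right]\right),$$ defined for those $b\in\mathcal B$ for which $b-S-D$ is invertible in $\mathcal M$. Let $\beta_1,\beta_2\in\mathcal B$ be such that either $\beta_1,\beta_2\in\mathbb H^+(\mathcal B)$, or $-\beta_1,-\beta_2\in\mathbb H^+(\mathcal B)$, or $\beta_1,-\beta_2\in\mathbb H^+(\mathcal B)$, or $-\beta_1,\beta_2\in\mathbb H^+(\mathcal B)$. Then $\beta_j-S-D$ and $\omega(\beta_j)-D$ are invertible in $\mathcal M$ for $j=1,2$, and the spectrum of the bounded linear operator $u_{\beta_1,\beta_2}$ on the Banach space $\mathcal B$ defined by $$u_{\beta_1,\beta_2}(v)=E\left[(\omega(\beta_1)-D)^{-1}\,\eta(v)\,(\omega(\beta_2)-D)^{-1}\right]$$ is contained in the open unit disk $\{z\in\mathbb C:|z|<1\}$; in other words, the spectral radius of $u_{\beta_1,\beta_2}$ is strictly less than $1$. -/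

import Mathlib

namespace OpValuedFree

/-- The operator upper half-plane `ℍ⁺(B)` of a unital C⋆-algebra `B`: the elements `b` whose
imaginary part `(b - b⋆) / (2i)` is positive and invertible. -/
def upperHalfPlane (B : Type*) [CStarAlgebra B] [PartialOrder B] [StarOrderedRing B] : Set B :=
  {b | IsStrictlyPositive (imaginaryPart b : B)}

/-- A `B`-valued C⋆-probability space: `ι` exhibits `B` as a unital C⋆-subalgebra of `M`
(`ι` is injective by `map_incl`), and the structure is a positive conditional expectation of `M`
onto `B`, that is, a positive linear `B`-bimodule map which is the identity on `B`. -/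
structure CondExp {B M : Type*} [CStarAlgebra B] [PartialOrder B]
    [CStarAlgebra M] [PartialOrder M] (ι : B →⋆ₐ[ℂ] M) extends M →ₚ[ℂ] B where
  map_incl : ∀ b : B, toFun (ι b) = b
  map_bimodule : ∀ (b₁ b₂ : B) (a : M), toFun (ι b₁ * a * ι b₂) = b₁ * toFun a * b₂

section

variable {B M : Type*} [CStarAlgebra B] [PartialOrder B] [CStarAlgebra M] [PartialOrder M]
  {ι : B →⋆ₐ[ℂ] M}

instance : FunLike (CondExp ι) M B where
  coe E := E.toFun
  coe_injective E F h := by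
    cases E
    cases F
    congr
    exact DFunLike.coe_injective h

instance : LinearMapClass (CondExp ι) ℂ M B where
  map_add E := map_add E.toPositiveLinearMap
  map_smulₛₗ E := map_smul E.toPositiveLinearMap

instance : OrderHomClass (CondExp ι) M B where
  map_rel E _ _ h := OrderHomClass.mono E.toPositiveLinearMap h

end

/-- Freeness with amalgamation over `B`, with respect to `E`, of a family of subalgebras `A i` of
`M`: each `A i` contains `B`, and `E (a₁ a₂ ⋯ aₙ) = 0` whenever `n ≥ 1`, `aⱼ ∈ A (iⱼ)`,
`E aⱼ = 0` for all `j`, and `i₁ ≠ i₂ ≠ ⋯ ≠ iₙ` (neighbouring indices differ).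
The list `l` is `[(i₁, a₁), …, (iₙ, aₙ)]`. -/
def FreeSubalgebras {B M κ : Type*} [CStarAlgebra B] [PartialOrder B]
    [CStarAlgebra M] [PartialOrder M] {ι : B →⋆ₐ[ℂ] M} (E : CondExp ι)
    (A : κ → Subalgebra ℂ M) : Prop :=
  (∀ i b, ι b ∈ A i) ∧
    ∀ l : List (κ × M), l ≠ [] → l.IsChain (fun p q => p.1 ≠ q.1) →
      (∀ p ∈ l, p.2 ∈ A p.1 ∧ E p.2 = 0) → E (l.map Prod.snd).prod = 0

/-- The (algebraic) subalgebra of `M` generated by `B` and the element `X`. -/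
def algebraGeneratedBy {B M : Type*} [CStarAlgebra B] [CStarAlgebra M]
    (ι : B →⋆ₐ[ℂ] M) (X : M) : Subalgebra ℂ M :=
  Algebra.adjoin ℂ (Set.range ι ∪ {X})

/-- `X` and `Y` are free with amalgamation over `B` with respect to `E`. -/
def Free {B M : Type*} [CStarAlgebra B] [PartialOrder B]
    [CStarAlgebra M] [PartialOrder M] {ι : B →⋆ₐ[ℂ] M} (E : CondExp ι) (X Y : M) : Prop :=
  FreeSubalgebras E (fun i : Fin 2 => algebraGeneratedBy ι (![X, Y] i))

/-- The word `S b₁ S b₂ ⋯ S bₙ` attached to a list `[b₁, …, bₙ]` of coefficients. -/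
def word {B M : Type*} [CStarAlgebra B] [CStarAlgebra M]
    (ι : B →⋆ₐ[ℂ] M) (S : M) (l : List B) : M :=
  (l.map fun b => S * ι b).prod

/-- The sum over all noncrossing pair partitions of the `n` letters `S` of the word
`S b₁ S b₂ ⋯ S bₙ` of the associated nested evaluation of `η`, for the list `[b₁, …, bₙ]`.
The terms are grouped according to the partner of the first letter. If the first letter is paired
with the letter in front of `bⱼ` (`j = i + 2` below), then a noncrossing pairing consists of a
noncrossing pairing of the letters in between and a noncrossing pairing of the letters that
follow, and contributes `η (b₁ · (inner part)) · bⱼ · (outer part)`. -/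
def pairingSum {B : Type*} [Semiring B] (η : B → B) : List B → B
  | [] => 1
  | b :: t => ∑ i : Fin t.length,
      η (b * pairingSum η (t.take i)) * t[i] * pairingSum η (t.drop (i + 1))
termination_by l => l.length
decreasing_by
  all_goals simp

/-- `S` is a centred (selfadjoint) `B`-valued semicircular element with operator-valued variance
`η`: its `B`-valued moments are given by the `B`-valued moment-cumulant formula in which the only
nonzero `B`-valued free cumulant is the second one, equal to `η`. In particular `E S = 0` and
`E (S b S) = η b`. -/
def IsCentredSemicircular {B M : Type*} [CStarAlgebra B] [PartialOrder B]
    [CStarAlgebra M] [PartialOrder M] {ι : B →⋆ₐ[ℂ] M} (E : CondExp ι) (η : B → B) (S : M) :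
    Prop :=
  IsSelfAdjoint S ∧ ∀ l : List B, E (word ι S l) = pairingSum η l

/-- The subordination function `ω(b) = b - η(E[(b - S - D)⁻¹])`, for `b - S - D` invertible. -/
noncomputable def subordination {B M : Type*} [CStarAlgebra B] [PartialOrder B]
    [CStarAlgebra M] [PartialOrder M] {ι : B →⋆ₐ[ℂ] M} (E : CondExp ι) (η : B → B) (S D : M)
    (b : B) : B :=
  b - η (E (Ring.inverse (ι b - S - D)))

/-- The bounded linear operator `v ↦ E[(w₁ - D)⁻¹ η(v) (w₂ - D)⁻¹]` on `B`, for `w₁ - D` and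
`w₂ - D` invertible in `M`. -/
noncomputable def transferOperator {B M : Type*} [CStarAlgebra B] [PartialOrder B]
    [StarOrderedRing B] [CStarAlgebra M] [PartialOrder M] [StarOrderedRing M]
    {ι : B →⋆ₐ[ℂ] M} (E : CondExp ι) (η : CompletelyPositiveMap B B) (D : M) (w₁ w₂ : B) :
    B →L[ℂ] B where
  toFun v := E (Ring.inverse (ι w₁ - D) * ι (η v) * Ring.inverse (ι w₂ - D))
  map_add' v w := by simp [mul_add, add_mul]
  map_smul' c v := by simp
  cont := by
    have hE : Continuous E := map_continuous E
    have hη : Continuous η := map_continuous η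
    have hι : Continuous ι := map_continuous ι
    fun_prop

end OpValuedFree

/-!
The proof has two halves: the subordination identity `E[(β - S - D)⁻¹] = E[(ω(β) - D)⁻¹]`, and a
Perron–Frobenius argument which deduces the spectral bound from it.

*Subordination* (`subordination_eq`). Both sides are analytic along `z ↦ β + z`, so it is enough to
treat large `z`. For large `w` put `g = E[(w - D)⁻¹]` and `v = g⁻¹ + η(g)`. The recursion of the
noncrossing pairings gives the equation `v G = 1 + η(G) G` for `G = E[(v - S)⁻¹]`, and its small
solution is unique, so `E[(v - S)⁻¹] = g` as well. Writing `(w - D)⁻¹ = g (1 + p)` and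
`(v - S)⁻¹ = g (1 + q)`, the elements `p` and `q` are centred, and
`w + η(g) - S - D = (w - D) + (v - S) - g⁻¹ = (w - D) g (1 - p q) (v - S)`. The inverse is therefore
`g (1 + q) ∑ₖ (p q)ᵏ (1 + p)`, and by freeness only the constant term survives under `E`: the
conditional expectation of the resolvent at `w + η(g)` is `g`. Since `ω` is injective for large
arguments, `β = w + η(g)` when `w = ω(β)`.

*Contraction* (`exists_contraction`). For `β` in the upper half-plane, `R = (ω(β) - D)⁻¹` and
`p = -Im E[R] > 0`, taking imaginary parts in the subordination identity gives
`p = E[R (Im β) R⋆] + E[R η(p) R⋆]`, and the first summand is bounded below by a multiple of `p`.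
Hence `E[R η(p) R⋆] ≤ r p` with `r < 1`, and likewise `E[R⋆ η(p) R] ≤ r p`. The lower half-plane
follows by taking adjoints.

*Mixed pairs* (`exists_norm_pow_le`). For two arguments, positivity of the `2 × 2` matrix with rows
`(p₁, v)` and `(v⋆, p₂)` is preserved by applying `η`, compressing by `diag(R₁, R₂⋆)` and applying
`E`. The diagonal entries shrink by the factor `r` in each step, so the off-diagonal entries
`uⁿ(v)` decay like `rⁿ`. This handles all four sign combinations at once.
-/

namespace OpValuedFree

open Filter Topology Bornology

/-! ### Inverses, imaginary parts and strict positivity -/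

section Ring

variable {R : Type*} [Ring R] {a b : R}

lemma ringInverse_mul (ha : IsUnit a) (hb : IsUnit b) :
    Ring.inverse (a * b) = Ring.inverse b * Ring.inverse a := by
  obtain ⟨u, rfl⟩ := ha
  obtain ⟨v, rfl⟩ := hb
  rw [← Units.val_mul, Ring.inverse_unit, Ring.inverse_unit, Ring.inverse_unit, mul_inv_rev,
    Units.val_mul]

lemma ringInverse_smul [Algebra ℂ R] {c : ℂ} (hc : c ≠ 0) (ha : IsUnit a) :
    Ring.inverse (c • a) = c⁻¹ • Ring.inverse a := by
  obtain ⟨u, rfl⟩ := ha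
  rw [Ring.inverse_unit]
  exact Ring.inverse_unit ⟨c • (u : R), c⁻¹ • ↑u⁻¹, by simp [smul_smul, hc],
    by simp [smul_smul, hc]⟩

lemma map_ringInverse {R' F : Type*} [Ring R'] [FunLike F R R'] [MonoidHomClass F R R'] (f : F)
    (ha : IsUnit a) : f (Ring.inverse a) = Ring.inverse (f a) := by
  obtain ⟨u, rfl⟩ := ha
  exact (Ring.inverse_unit u).symm ▸ (Ring.inverse_unit (Units.map (f : R →* R') u)).symm

end Ring

section Star

variable {A : Type*} [CStarAlgebra A]

lemma imaginaryPart_star (a : A) : (imaginaryPart (star a) : A) = -(imaginaryPart a : A) := by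
  simp only [imaginaryPart_apply_coe, star_star]
  rw [← smul_neg, ← smul_neg, neg_sub]

/-- `-Im a⁻¹ = a⁻¹ (Im a) (a⁻¹)⋆`, from `a⁻¹ - (a⁻¹)⋆ = a⁻¹ (a⋆ - a) (a⁻¹)⋆`. -/
lemma imaginaryPart_inverse {a : A} (ha : IsUnit a) :
    -(imaginaryPart (Ring.inverse a) : A) =
      Ring.inverse a * (imaginaryPart a : A) * star (Ring.inverse a) := by
  obtain ⟨u, rfl⟩ := ha
  have h1 : (↑u⁻¹ : A) - star ↑u⁻¹ = ↑u⁻¹ * (star ↑u - ↑u) * star (↑u⁻¹ : A) := by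
    have : star (u : A) * star (↑u⁻¹ : A) = 1 := by rw [← star_mul]; simp
    simp [mul_sub, sub_mul, mul_assoc, this]
  rw [Ring.inverse_unit, imaginaryPart_apply_coe, imaginaryPart_apply_coe, h1,
    ← neg_sub (star (u : A))]
  simp only [smul_neg, neg_smul, neg_neg, mul_smul_comm, smul_mul_assoc]

/-- The variant of `imaginaryPart_inverse` with the adjoint on the left. -/
lemma imaginaryPart_inverse' {a : A} (ha : IsUnit a) :
    -(imaginaryPart (Ring.inverse a) : A) =
      star (Ring.inverse a) * (imaginaryPart a : A) * Ring.inverse a := by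
  obtain ⟨u, rfl⟩ := ha
  have h1 : (↑u⁻¹ : A) - star ↑u⁻¹ = star (↑u⁻¹ : A) * (star ↑u - ↑u) * ↑u⁻¹ := by
    have : star (↑u⁻¹ : A) * star (u : A) = 1 := by rw [← star_mul]; simp
    simp [mul_sub, sub_mul, this]
  rw [Ring.inverse_unit, imaginaryPart_apply_coe, imaginaryPart_apply_coe, h1,
    ← neg_sub (star (u : A))]
  simp only [smul_neg, neg_smul, neg_neg, mul_smul_comm, smul_mul_assoc]

lemma map_imaginaryPart {F A₁ A₂ : Type*} [CStarAlgebra A₁] [CStarAlgebra A₂]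
    [FunLike F A₁ A₂] [LinearMapClass F ℂ A₁ A₂] [StarHomClass F A₁ A₂] (f : F) (a : A₁) :
    f (imaginaryPart a : A₁) = (imaginaryPart (f a) : A₂) := by
  simp only [imaginaryPart_apply_coe, ← Complex.coe_smul, map_smul, map_sub, map_star]

end Star

section Order

variable {A : Type*} [CStarAlgebra A] [PartialOrder A] [StarOrderedRing A]

lemma exists_smul_one_le {a : A} (ha : IsStrictlyPositive a) :
    ∃ δ : ℝ, 0 < δ ∧ δ • (1 : A) ≤ a := by
  rcases subsingleton_or_nontrivial A with h | h
  · exact ⟨1, one_pos, by simp [Subsingleton.elim a 0, Subsingleton.elim (1 : A) 0]⟩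
  · obtain ⟨r, hr, h⟩ := (CFC.exists_pos_algebraMap_le_iff (a := a) ha.isSelfAdjoint).2
      fun x hx ↦ ha.spectrum_pos hx
    exact ⟨r, hr, by rwa [← Algebra.algebraMap_eq_smul_one]⟩

lemma isStrictlyPositive_of_smul_one_le {a : A} {δ : ℝ} (hδ : 0 < δ) (h : δ • (1 : A) ≤ a) :
    IsStrictlyPositive a :=
  (isStrictlyPositive_one.smul hδ).of_le h

lemma le_smul_one_of_norm_le {a : A} (ha : IsSelfAdjoint a) {C : ℝ} (h : ‖a‖ ≤ C) :
    a ≤ C • (1 : A) := by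
  have h1 := ha.le_algebraMap_norm_self
  rw [Algebra.algebraMap_eq_smul_one] at h1
  exact h1.trans (smul_le_smul_of_nonneg_right h zero_le_one)

lemma norm_le_of_le_smul_one {a : A} (ha : 0 ≤ a) {C : ℝ} (hC : 0 ≤ C) (h : a ≤ C • (1 : A)) :
    ‖a‖ ≤ C :=
  (CStarAlgebra.norm_le_iff_le_algebraMap a hC).2 (by rwa [Algebra.algebraMap_eq_smul_one])

/-- Writing `a = x + i y` with `y = s²` and `s` selfadjoint and invertible,
`s⁻¹ a s⁻¹ = s⁻¹ x s⁻¹ + i`, and `-i` is not in the spectrum of a selfadjoint element. -/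
lemma isUnit_of_isStrictlyPositive_imaginaryPart {a : A}
    (ha : IsStrictlyPositive (imaginaryPart a : A)) : IsUnit a := by
  set s : A := CFC.sqrt (imaginaryPart a : A) with hs
  have hsu : IsUnit s := ha.isUnit_cfcSqrt
  have hss : s * s = (imaginaryPart a : A) := CFC.sqrt_mul_sqrt_self _ ha.nonneg
  have hsa : IsSelfAdjoint s := (CFC.sqrt_nonneg _).isSelfAdjoint
  obtain ⟨u, hu⟩ := hsu
  have hui : IsSelfAdjoint (↑u⁻¹ : A) := by
    have : IsSelfAdjoint u := Units.ext (by rw [Units.coe_star, hu]; exact hsa)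
    have h2 : IsSelfAdjoint (u⁻¹ : Aˣ) := this.inv
    exact congrArg Units.val h2
  set x : A := ↑u⁻¹ * (realPart a : A) * ↑u⁻¹ with hx
  have hxs : IsSelfAdjoint x := by
    have h0 : star (realPart a : A) = (realPart a : A) := (realPart a).2
    rw [hx, IsSelfAdjoint, star_mul, star_mul, hui.star_eq, h0, mul_assoc]
  have hI : IsUnit (x + Complex.I • (1 : A)) := by
    by_contra hn
    have hmem : -Complex.I ∈ spectrum ℂ x := by
      rw [spectrum.mem_iff]
      intro h
      apply hn
      have : x + Complex.I • (1 : A) = -(algebraMap ℂ A (-Complex.I) - x) := by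
        rw [Algebra.algebraMap_eq_smul_one, neg_smul]; abel
      rw [this]; exact h.neg
    have := hxs.mem_spectrum_eq_re hmem
    have h2 := congrArg Complex.im this
    simp at h2
  have hfac : a = ↑u * (x + Complex.I • (1 : A)) * ↑u := by
    conv_lhs => rw [← realPart_add_I_smul_imaginaryPart a, ← hss, ← hu]
    simp [hx, mul_add, add_mul, mul_assoc]
  rw [hfac]
  exact (u.isUnit.mul hI).mul u.isUnit

lemma isStrictlyPositive_neg_imaginaryPart_inverse {a : A}
    (ha : IsStrictlyPositive (imaginaryPart a : A)) :
    IsStrictlyPositive (-(imaginaryPart (Ring.inverse a) : A)) := by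
  have hu := isUnit_of_isStrictlyPositive_imaginaryPart ha
  rw [imaginaryPart_inverse hu]
  exact (hu.ringInverse.isStrictlyPositive_star_right_conjugate_iff).2 ha

end Order

/-! ### Conditional expectations -/

section CondExp

variable {B M : Type*} [CStarAlgebra B] [PartialOrder B] [CStarAlgebra M] [PartialOrder M]
  {ι : B →⋆ₐ[ℂ] M} (E : CondExp ι)

lemma CondExp.apply_incl (b : B) : E (ι b) = b := E.map_incl b

lemma CondExp.map_incl_mul_incl (b₁ b₂ : B) (a : M) : E (ι b₁ * a * ι b₂) = b₁ * E a * b₂ :=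
  E.map_bimodule b₁ b₂ a

lemma CondExp.map_one : E (1 : M) = 1 := by
  have h := E.apply_incl 1
  rwa [_root_.map_one ι] at h

lemma CondExp.map_incl_mul (b : B) (a : M) : E (ι b * a) = b * E a := by
  have h := E.map_incl_mul_incl b 1 a
  rwa [_root_.map_one ι, mul_one, mul_one] at h

variable [StarOrderedRing B] [StarOrderedRing M]

lemma CondExp.isStrictlyPositive {a : M} (ha : IsStrictlyPositive a) :
    IsStrictlyPositive (E a) := by
  obtain ⟨δ, hδ, h⟩ := exists_smul_one_le ha
  refine isStrictlyPositive_of_smul_one_le hδ ?_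
  have := OrderHomClass.mono E h
  rwa [← Complex.coe_smul, map_smul, E.map_one, Complex.coe_smul] at this

lemma isStrictlyPositive_incl (ι : B →⋆ₐ[ℂ] M) {b : B} (hb : IsStrictlyPositive b) :
    IsStrictlyPositive (ι b) :=
  ⟨map_nonneg ι hb.nonneg, hb.isUnit.map ι⟩

end CondExp

/-! ### Resolvents of semicircular elements -/

section Continuity

variable {F A₁ A₂ : Type*} [CStarAlgebra A₁] [PartialOrder A₁] [StarOrderedRing A₁]
  [CStarAlgebra A₂] [PartialOrder A₂] [StarOrderedRing A₂] [FunLike F A₁ A₂]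
  [LinearMapClass F ℂ A₁ A₂] [OrderHomClass F A₁ A₂]

/-- A positive linear map between C⋆-algebras, as a bounded linear map. -/
noncomputable def positiveCLM (f : F) : A₁ →L[ℂ] A₂ :=
  { (f : A₁ →ₗ[ℂ] A₂) with cont := map_continuous f }

@[simp] lemma positiveCLM_apply (f : F) (a : A₁) : positiveCLM f a = f a := rfl

end Continuity

section Semicircular

variable {B : Type*} [Ring B]

/-- The Catalan-type recursion of the moments `E[(S h)ⁿ]`, by the partner of the first letter. -/
lemma pairingSum_replicate_succ_succ (η : B → B) (h : B) (n : ℕ) :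
    pairingSum η (List.replicate (n + 2) h) =
      ∑ p ∈ Finset.HasAntidiagonal.antidiagonal n, η (h * pairingSum η (List.replicate p.1 h)) *
        (h * pairingSum η (List.replicate p.2 h)) := by
  rw [List.replicate_succ, pairingSum, Finset.Nat.sum_antidiagonal_eq_sum_range_succ
    (fun i j => η (h * pairingSum η (List.replicate i h)) *
        (h * pairingSum η (List.replicate j h))), Finset.sum_range]
  refine Fintype.sum_equiv (finCongr (by simp)) _ _ fun i => ?_
  have hi : (i : ℕ) < n + 1 := by simpa using i.2
  simp only [List.take_replicate, List.drop_replicate, Fin.getElem_fin, List.getElem_replicate,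
    finCongr_apply, Fin.val_cast, mul_assoc]
  rw [min_eq_left hi.le, Nat.add_sub_add_right]

end Semicircular

section

variable {B M : Type*} [CStarAlgebra B] [PartialOrder B] [StarOrderedRing B]
  [CStarAlgebra M] [PartialOrder M] [StarOrderedRing M]
  {ι : B →⋆ₐ[ℂ] M} {E : CondExp ι} {η : CompletelyPositiveMap B B} {S D : M}

/-- The Cauchy product turns the recursion of the noncrossing pairings into a quadratic equation
for the geometric series of `S h`. -/
lemma IsCentredSemicircular.geometric_eq (hS : IsCentredSemicircular E η S) {h : B}
    (hh : ‖S * ι h‖ < 1) :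
    E (Ring.inverse (1 - S * ι h)) = 1 + η (h * E (Ring.inverse (1 - S * ι h))) *
      (h * E (Ring.inverse (1 - S * ι h))) := by
  set X := E (Ring.inverse (1 - S * ι h)) with hX
  set m : ℕ → B := fun n => pairingSum η (List.replicate n h) with hm
  have hmE : ∀ n, E ((S * ι h) ^ n) = m n := fun n => by
    simp only [hm]
    rw [← hS.2]; simp [word]
  have hgeo : HasSum (fun n => (S * ι h) ^ n) (Ring.inverse (1 - S * ι h)) := by
    rw [NormedRing.inverse_one_sub _ hh]
    exact (summable_geometric_of_norm_lt_one hh).hasSum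
  have hsum : HasSum m X := by
    have := (positiveCLM E).hasSum hgeo
    simpa [hmE] using this
  have hnorm : Summable fun n => ‖m n‖ := by
    refine Summable.of_nonneg_of_le (fun _ => norm_nonneg _) (fun n => ?_)
      ((summable_norm_geometric_of_norm_lt_one hh).mul_left ‖positiveCLM E‖)
    rw [← hmE]
    exact (positiveCLM E).le_opNorm _
  have hb : Summable fun n => ‖h * m n‖ :=
    Summable.of_nonneg_of_le (fun _ => norm_nonneg _) (fun n => norm_mul_le _ _)
      (hnorm.mul_left ‖h‖)
  have ha : Summable fun n => ‖η (h * m n)‖ :=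
    Summable.of_nonneg_of_le (fun _ => norm_nonneg _)
      (fun n => (positiveCLM η).le_opNorm _) (hb.mul_left ‖positiveCLM η‖)
  have hbs : HasSum (fun n => h * m n) (h * X) := hsum.mul_left h
  have has : HasSum (fun n => η (h * m n)) (η (h * X)) := (positiveCLM η).hasSum hbs
  have hprod := tsum_mul_tsum_eq_tsum_sum_antidiagonal_of_summable_norm ha hb
  rw [has.tsum_eq, hbs.tsum_eq] at hprod
  have hrec : ∀ n, m (n + 2) =
      ∑ p ∈ Finset.HasAntidiagonal.antidiagonal n, η (h * m p.1) * (h * m p.2) :=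
    pairingSum_replicate_succ_succ η h
  simp only [← hrec] at hprod
  have h0 : m 0 = 1 := by simp [hm, pairingSum]
  have h1 : m 1 = 0 := by simp [hm, pairingSum]
  rw [hprod, ← hsum.tsum_eq, ← hsum.summable.sum_add_tsum_nat_add 2]
  simp [Finset.sum_range_succ, h0, h1]

/-- The operator-valued semicircular equation `v G = 1 + η(G) G` for `G = E[(v - S)⁻¹]`. -/
lemma IsCentredSemicircular.resolvent_eq (hS : IsCentredSemicircular E η S) {v : B}
    (hv : IsUnit v) (hh : ‖S * ι (Ring.inverse v)‖ < 1) :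
    v * E (Ring.inverse (ι v - S)) = 1 + η (E (Ring.inverse (ι v - S))) *
      E (Ring.inverse (ι v - S)) := by
  obtain ⟨u, rfl⟩ := hv
  have hu : Ring.inverse (u : B) = ↑u⁻¹ := Ring.inverse_unit u
  rw [hu] at hh
  have hinv : Ring.inverse (ι u - S) = ι ↑u⁻¹ * Ring.inverse (1 - S * ι ↑u⁻¹) := by
    have h1 : ι (u : B) - S = (1 - S * ι ↑u⁻¹) * ι u := by
      have : ι (↑u⁻¹ : B) * ι u = 1 := by rw [← map_mul]; simp
      simp [sub_mul, mul_assoc, this]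
    rw [h1, ringInverse_mul (isUnit_one_sub_of_norm_lt_one hh) (u.isUnit.map ι),
      ← map_ringInverse ι u.isUnit, Ring.inverse_unit]
  have := hS.geometric_eq hh
  rw [hinv, E.map_incl_mul, ← this]
  simp

end

/-! ### Alternating products of free elements -/

section Alternating

/-- The alternating list `[i, i + 1, i, …]` of length `n` in `Fin 2`. -/
def alternating : ℕ → Fin 2 → List (Fin 2)
  | 0, _ => []
  | n + 1, i => i :: alternating n (i + 1)

lemma isChain_alternating (n : ℕ) (i : Fin 2) : (alternating n i).IsChain (· ≠ ·) := by
  induction n generalizing i with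
  | zero => simp [alternating]
  | succ n ih =>
    cases n with
    | zero => simp [alternating]
    | succ n =>
      have := ih (i + 1)
      rw [alternating] at this ⊢
      rw [alternating, List.isChain_cons_cons]
      exact ⟨by fin_cases i <;> decide, this⟩

lemma prod_map_alternating {M : Type*} [Monoid M] (x : Fin 2 → M) (k : ℕ) (i : Fin 2) :
    ((alternating (2 * k) i).map x).prod = (x i * x (i + 1)) ^ k := by
  induction k with
  | zero => simp [alternating]
  | succ k ih =>
    have hi : i + 1 + 1 = i := by fin_cases i <;> rfl
    rw [mul_add, mul_one, pow_succ', ← ih]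
    simp [alternating, hi, mul_assoc]

end Alternating

/-- If `a` is close enough to a scalar `z`, its inverse is a Neumann series in `1 - z⁻¹ a`, hence
lies in the norm closure of any subalgebra containing `a`. -/
lemma inverse_mem_closure {M : Type*} [NormedRing M] [NormedAlgebra ℂ M] [CompleteSpace M]
    (A : Subalgebra ℂ M) {a : M} (ha : a ∈ A) {z : ℂ} (hz : z ≠ 0)
    (h : ‖1 - z⁻¹ • a‖ < 1) : Ring.inverse a ∈ closure (A : Set M) := by
  have hgeo : Ring.inverse (z⁻¹ • a) ∈ closure (A : Set M) := by
    have h1 : Ring.inverse (1 - (1 - z⁻¹ • a)) = ∑' n : ℕ, (1 - z⁻¹ • a) ^ n :=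
      NormedRing.inverse_one_sub _ h
    rw [sub_sub_cancel] at h1
    rw [h1]
    refine mem_closure_of_tendsto (summable_geometric_of_norm_lt_one h).hasSum ?_
    exact .of_forall fun s => sum_mem fun n _ => pow_mem (sub_mem (one_mem _) (A.smul_mem ha _)) n
  have hu : IsUnit (z⁻¹ • a) := by
    have := isUnit_one_sub_of_norm_lt_one h
    rwa [sub_sub_cancel] at this
  have ha' : Ring.inverse a = z⁻¹ • Ring.inverse (z⁻¹ • a) := by
    conv_lhs => rw [show a = z • z⁻¹ • a by simp [smul_smul, hz], ringInverse_smul hz hu]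
  rw [ha']
  exact A.topologicalClosure.smul_mem hgeo _

section Freeness

variable {B M : Type*} [CStarAlgebra B] [PartialOrder B] [StarOrderedRing B]
  [CStarAlgebra M] [PartialOrder M] [StarOrderedRing M]
  {ι : B →⋆ₐ[ℂ] M} {E : CondExp ι} {S D : M}

/-- Freeness passes to the norm closures of the two algebras: a centred element of a closure is a
limit of centred elements `a - E a`. -/
lemma Free.apply_prod_eq_zero (hfree : Free E S D) {x : Fin 2 → M}
    (hx : ∀ i, x i ∈ closure (algebraGeneratedBy ι (![S, D] i) : Set M))
    (h0 : ∀ i, E (x i) = 0) {L : List (Fin 2)} (hL : L ≠ []) (hc : L.IsChain (· ≠ ·)) :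
    E (L.map x).prod = 0 := by
  choose u hu hux using fun i => mem_closure_iff_seq_limit.1 (hx i)
  have hE : Continuous E := map_continuous E
  have hι : Continuous ι := map_continuous ι
  have hy : ∀ i, Tendsto (fun n => u i n - ι (E (u i n))) atTop (𝓝 (x i)) := fun i => by
    have h1 := (hux i).sub (((hι.comp hE).tendsto (x i)).comp (hux i))
    simpa [Function.comp_def, h0] using h1
  have hlim : Tendsto (fun n => E (L.map fun i => u i n - ι (E (u i n))).prod) atTop
      (𝓝 (E (L.map x).prod)) :=
    (hE.tendsto _).comp (tendsto_list_prod L fun i _ => hy i)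
  refine tendsto_nhds_unique hlim (tendsto_const_nhds.congr fun n => ?_)
  have := hfree.2 (L.map fun i => (i, u i n - ι (E (u i n)))) (by simpa using hL)
    ((List.isChain_map _).2 hc) (by
      intro p hp
      obtain ⟨i, -, rfl⟩ := List.mem_map.1 hp
      refine ⟨sub_mem (hu i n) (hfree.1 i _), ?_⟩
      rw [map_sub, E.apply_incl, sub_self])
  simpa [Function.comp_def] using this.symm

/-- Expanding the inverse in a geometric series, all terms but the constant one are alternating
products of centred elements. -/
lemma Free.apply_alternating_resolvent (hfree : Free E S D) {p q : M}
    (hq : q ∈ closure (algebraGeneratedBy ι S : Set M))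
    (hp : p ∈ closure (algebraGeneratedBy ι D : Set M)) (hEp : E p = 0) (hEq : E q = 0)
    (hpq : ‖p * q‖ < 1) :
    E ((1 + q) * Ring.inverse (1 - p * q) * (1 + p)) = 1 := by
  have hgeo : HasSum (fun n => (p * q) ^ n) (Ring.inverse (1 - p * q)) := by
    rw [NormedRing.inverse_one_sub _ hpq]
    exact (summable_geometric_of_norm_lt_one hpq).hasSum
  have h1 : HasSum (fun n => E ((1 + q) * (p * q) ^ n * (1 + p)))
      (E ((1 + q) * Ring.inverse (1 - p * q) * (1 + p))) :=
    (positiveCLM E).hasSum ((hgeo.mul_left (1 + q)).mul_right (1 + p))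
  have hz : ∀ n i, n ≠ 0 → E ((alternating n i).map ![q, p]).prod = 0 := fun n i hn =>
    hfree.apply_prod_eq_zero (fun j => by fin_cases j <;> simpa)
      (fun j => by fin_cases j <;> simpa)
      (by cases n <;> simp_all [alternating]) (isChain_alternating n i)
  have h2 : ∀ n, E ((1 + q) * (p * q) ^ n * (1 + p)) = if n = 0 then 1 else 0 := by
    intro n
    have e1 : (p * q) ^ n = ((alternating (2 * n) 1).map ![q, p]).prod := by
      rw [prod_map_alternating]; simp
    have e2 : q * (p * q) ^ n = ((alternating (2 * n + 1) 0).map ![q, p]).prod := by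
      rw [e1]; simp [alternating]
    have e3 : (p * q) ^ n * p = ((alternating (2 * n + 1) 1).map ![q, p]).prod := by
      have : ((alternating (2 * n) 0).map ![q, p]).prod = (q * p) ^ n := by
        rw [prod_map_alternating]; simp
      simp only [alternating, List.map_cons, List.prod_cons]
      rw [show (1 : Fin 2) + 1 = 0 from rfl, this]
      exact mul_pow_mul p q n
    have e4 : q * (p * q) ^ n * p = ((alternating (2 * n + 2) 0).map ![q, p]).prod := by
      rw [mul_assoc, e3]; simp [alternating]
    have : (1 + q) * (p * q) ^ n * (1 + p) =
        (p * q) ^ n + q * (p * q) ^ n + (p * q) ^ n * p + q * (p * q) ^ n * p := by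
      noncomm_ring
    rw [this, map_add, map_add, map_add, e4, e3, e2, hz _ _ (by simp), hz _ _ (by simp),
      hz _ _ (by simp)]
    split_ifs with hn
    · simp [hn, E.map_one]
    · rw [e1, hz _ _ (by simpa using hn)]; simp
  rw [← h1.tsum_eq]
  simp [h2]

end Freeness

/-! ### Subordination for large arguments -/

section Asymptotics

lemma tendsto_inv_smul_add {A : Type*} [NormedRing A] [NormedAlgebra ℂ A] {a b : ℂ → A} {v : A}
    (h : Tendsto (fun z => z⁻¹ • a z) (cobounded ℂ) (𝓝 1))
    (hb : Tendsto b (cobounded ℂ) (𝓝 v)) :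
    Tendsto (fun z => z⁻¹ • (a z + b z)) (cobounded ℂ) (𝓝 1) := by
  simpa using h.add (tendsto_inv₀_cobounded.smul hb)

variable {A : Type*} [NormedRing A] [NormedAlgebra ℂ A] [CompleteSpace A]
  {l : Filter ℂ} {k : ℂ → ℂ} {a : ℂ → A}

lemma eventually_isUnit_of_tendsto_smul (hk : ∀ᶠ z in l, k z ≠ 0)
    (h : Tendsto (fun z => k z • a z) l (𝓝 1)) : ∀ᶠ z in l, IsUnit (a z) := by
  filter_upwards [h.eventually (Units.isOpen.mem_nhds (isUnit_one (M := A))), hk] with z hz hkz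
  have h2 : a z = algebraMap ℂ A (k z)⁻¹ * (k z • a z) := by
    rw [← Algebra.smul_def, smul_smul, inv_mul_cancel₀ hkz, one_smul]
  rw [h2]
  exact ((isUnit_iff_ne_zero.2 (inv_ne_zero hkz)).map _).mul hz

lemma tendsto_smul_inverse (hk : ∀ᶠ z in l, k z ≠ 0)
    (h : Tendsto (fun z => k z • a z) l (𝓝 1)) :
    Tendsto (fun z => (k z)⁻¹ • Ring.inverse (a z)) l (𝓝 1) := by
  have h1 : Tendsto (fun z => Ring.inverse (k z • a z)) l (𝓝 1) := by
    have := (NormedRing.inverse_continuousAt (1 : Aˣ)).tendsto.comp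
      (by simpa using h : Tendsto (fun z => k z • a z) l (𝓝 ((1 : Aˣ) : A)))
    simpa [Function.comp_def] using this
  refine h1.congr' ?_
  filter_upwards [hk, eventually_isUnit_of_tendsto_smul hk h] with z hz hu
  exact ringInverse_smul hz hu

lemma eventually_ne_zero_cobounded : ∀ᶠ z in cobounded ℂ, z ≠ 0 :=
  eventually_ne_cobounded 0

lemma eventually_isUnit_of_inv_smul (h : Tendsto (fun z => z⁻¹ • a z) (cobounded ℂ) (𝓝 1)) :
    ∀ᶠ z in cobounded ℂ, IsUnit (a z) :=
  eventually_isUnit_of_tendsto_smul (k := fun z => z⁻¹)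
    (by simpa using eventually_ne_zero_cobounded) h

/-- A family `a z` with `a z / z → 1` has inverses with `z (a z)⁻¹ → 1`. -/
lemma tendsto_smul_inverse_of_inv_smul (h : Tendsto (fun z => z⁻¹ • a z) (cobounded ℂ) (𝓝 1)) :
    Tendsto (fun z => z • Ring.inverse (a z)) (cobounded ℂ) (𝓝 1) := by
  simpa using tendsto_smul_inverse (k := fun z => z⁻¹)
    (by simpa using eventually_ne_zero_cobounded) h

lemma tendsto_zero_of_tendsto_smul {V : Type*} [NormedAddCommGroup V] [NormedSpace ℂ V]
    {a : ℂ → V} {v : V} (h : Tendsto (fun z => z • a z) (cobounded ℂ) (𝓝 v)) :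
    Tendsto a (cobounded ℂ) (𝓝 0) := by
  have := tendsto_inv₀_cobounded.smul h
  rw [zero_smul] at this
  refine this.congr' ?_
  filter_upwards [eventually_ne_zero_cobounded] with z hz
  rw [smul_smul, inv_mul_cancel₀ hz, one_smul]

end Asymptotics

section Ring

lemma ringInverse_sub {R : Type*} [Ring R] {a b : R} (ha : IsUnit a) (hb : IsUnit b) :
    Ring.inverse a - Ring.inverse b = Ring.inverse a * (b - a) * Ring.inverse b := by
  obtain ⟨u, rfl⟩ := ha
  obtain ⟨v, rfl⟩ := hb
  simp [mul_sub, sub_mul]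

/-- The factorisation behind subordination: with `p = γ⁻¹ W⁻¹ - 1` and `q = γ⁻¹ V⁻¹ - 1`,
`W + V - γ⁻¹ = W γ (1 - p q) V`. -/
lemma inverse_add_sub_inverse {R : Type*} [Ring R] {W V γ p q : R} (hW : IsUnit W)
    (hV : IsUnit V) (hγ : IsUnit γ) (hp : p = Ring.inverse γ * Ring.inverse W - 1)
    (hq : q = Ring.inverse γ * Ring.inverse V - 1) (hpq : IsUnit (1 - p * q)) :
    Ring.inverse (W + V - Ring.inverse γ) =
      γ * ((1 + q) * Ring.inverse (1 - p * q) * (1 + p)) := by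
  have h1 : W + V - Ring.inverse γ = W * (γ * ((1 - p * q) * V)) := by
    subst hp hq
    obtain ⟨w, rfl⟩ := hW
    obtain ⟨v, rfl⟩ := hV
    obtain ⟨c, rfl⟩ := hγ
    simp [mul_sub, sub_mul, mul_assoc]
    abel
  rw [h1, ringInverse_mul hW (hγ.mul (hpq.mul hV)), ringInverse_mul hγ (hpq.mul hV),
    ringInverse_mul hpq hV]
  have h2 : γ * (1 + q) = Ring.inverse V := by
    rw [hq, add_sub_cancel, ← mul_assoc, Ring.mul_inverse_cancel _ hγ, one_mul]
  have h3 : 1 + p = Ring.inverse γ * Ring.inverse W := by rw [hp, add_sub_cancel]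
  rw [h3, ← h2]
  simp only [mul_assoc]

end Ring

lemma eq_zero_of_norm_le_mul {V : Type*} [NormedAddCommGroup V] {x : V} {k : ℝ} (hk : k < 1)
    (h : ‖x‖ ≤ k * ‖x‖) : x = 0 := by
  by_contra hx
  have : 0 < ‖x‖ := norm_pos_iff.2 hx
  nlinarith

section Subordination

variable {B M : Type*} [CStarAlgebra B] [PartialOrder B] [StarOrderedRing B]
  [CStarAlgebra M] [PartialOrder M] [StarOrderedRing M]
  {ι : B →⋆ₐ[ℂ] M} {E : CondExp ι} {η : CompletelyPositiveMap B B} {S D : M}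

/-- If `g` and `E[(v - S)⁻¹]` are both small solutions of the semicircular equation
`v g = 1 + η(g) g`, they agree. -/
lemma IsCentredSemicircular.apply_resolvent_eq (hS : IsCentredSemicircular E η S) {v g : B}
    (hv : IsUnit v) (hh : ‖S * ι (Ring.inverse v)‖ < 1) (hg : v * g = 1 + η g * g)
    (hsmall : ‖Ring.inverse v‖ * (‖positiveCLM η‖ * (‖E (Ring.inverse (ι v - S))‖ + ‖g‖)) < 1) :
    E (Ring.inverse (ι v - S)) = g := by
  have hG := hS.resolvent_eq hv hh
  set G := E (Ring.inverse (ι v - S))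
  rw [← sub_eq_zero]
  refine eq_zero_of_norm_le_mul hsmall ?_
  have h1 : v * (G - g) = η (G - g) * G + η g * (G - g) := by
    rw [mul_sub, hG, hg, map_sub]; noncomm_ring
  have h2 : G - g = Ring.inverse v * (η (G - g) * G + η g * (G - g)) := by
    rw [← h1, ← mul_assoc, Ring.inverse_mul_cancel _ hv, one_mul]
  have hη : ∀ x, ‖η x‖ ≤ ‖positiveCLM η‖ * ‖x‖ := (positiveCLM η).le_opNorm
  calc ‖G - g‖ = ‖Ring.inverse v * (η (G - g) * G + η g * (G - g))‖ := by rw [← h2]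
    _ ≤ ‖Ring.inverse v‖ * (‖η (G - g)‖ * ‖G‖ + ‖η g‖ * ‖G - g‖) :=
      (norm_mul_le _ _).trans (mul_le_mul_of_nonneg_left
        ((norm_add_le _ _).trans (add_le_add (norm_mul_le _ _) (norm_mul_le _ _)))
        (norm_nonneg _))
    _ ≤ ‖Ring.inverse v‖ * (‖positiveCLM η‖ * ‖G - g‖ * ‖G‖ +
        ‖positiveCLM η‖ * ‖g‖ * ‖G - g‖) := by
      gcongr <;> exact hη _
    _ = _ := by ring

lemma resolvent_tendsto (X : M) {b : ℂ → B}
    (hb : Tendsto (fun z => z⁻¹ • b z) (cobounded ℂ) (𝓝 1)) :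
    Tendsto (fun z => z⁻¹ • (ι (b z) - X)) (cobounded ℂ) (𝓝 1) := by
  have hι : Continuous ι := map_continuous ι
  have h1 : Tendsto (fun z => z⁻¹ • ι (b z)) (cobounded ℂ) (𝓝 1) := by
    have := (hι.tendsto 1).comp hb
    simpa [Function.comp_def] using this
  simpa [sub_eq_add_neg] using tendsto_inv_smul_add h1 (tendsto_const_nhds (x := -X))

lemma CondExp.tendsto_smul {a : ℂ → M}
    (h : Tendsto (fun z => z • a z) (cobounded ℂ) (𝓝 1)) :
    Tendsto (fun z => z • E (a z)) (cobounded ℂ) (𝓝 1) := by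
  have hE : Continuous E := map_continuous E
  have := (hE.tendsto 1).comp h
  simpa [Function.comp_def, E.map_one] using this

/-- The parametrised form of subordination: if `w` is large, in the sense of the smallness
hypotheses below, then `g = E[(w - D)⁻¹]` is also the conditional expectation of the resolvent of
`S + D` at `w + η(g)`. The proof applies the factorisation `inverse_add_sub_inverse` to `w - D` and
`v - S`, where `v` is chosen such that `E[(v - S)⁻¹] = g`. -/
lemma apply_resolvent_add (hS : IsCentredSemicircular E η S) (hfree : Free E S D) {w g : B} {z : ℂ}
    (hz : z ≠ 0) (hgdef : g = E (Ring.inverse (ι w - D))) (hg : IsUnit g)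
    (hw : IsUnit (ι w - D)) (hw1 : ‖1 - z⁻¹ • (ι w - D)‖ < 1)
    {v : B} (hvdef : v = Ring.inverse g + η g) (hv : IsUnit v)
    (hvS : IsUnit (ι v - S)) (hv1 : ‖1 - z⁻¹ • (ι v - S)‖ < 1)
    (hh : ‖S * ι (Ring.inverse v)‖ < 1)
    (hsmall : ‖Ring.inverse v‖ * (‖positiveCLM η‖ * (‖E (Ring.inverse (ι v - S))‖ + ‖g‖)) < 1)
    (hpq : ‖(Ring.inverse (ι g) * Ring.inverse (ι w - D) - 1) *
      (Ring.inverse (ι g) * Ring.inverse (ι v - S) - 1)‖ < 1) :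
    E (Ring.inverse (ι (w + η g) - S - D)) = g := by
  have hvg : v * g = 1 + η g * g := by
    rw [hvdef, add_mul, Ring.inverse_mul_cancel _ hg]
  have hGS := hS.apply_resolvent_eq hv hh hvg hsmall
  have hιg : Ring.inverse (ι g) = ι (Ring.inverse g) := (map_ringInverse ι hg).symm
  have hmem : ∀ (X : M) (b : B), (∀ b, ι b ∈ algebraGeneratedBy ι X) →
      ‖1 - z⁻¹ • (ι b - X)‖ < 1 → Ring.inverse (ι g) * Ring.inverse (ι b - X) - 1 ∈
        closure (algebraGeneratedBy ι X : Set M) := by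
    intro X b hb h
    have hX : X ∈ algebraGeneratedBy ι X := Algebra.subset_adjoin (by simp)
    have h1 := inverse_mem_closure (algebraGeneratedBy ι X) (sub_mem (hb b) hX) hz h
    have h2 : Ring.inverse (ι g) ∈ (algebraGeneratedBy ι X).topologicalClosure := by
      rw [hιg]; exact subset_closure (hb _)
    exact sub_mem (mul_mem h2 h1) (one_mem (algebraGeneratedBy ι X).topologicalClosure)
  have hEz : ∀ a : M, E a = g → E (Ring.inverse (ι g) * a - 1) = 0 := by
    intro a ha
    rw [hιg, map_sub, E.map_incl_mul, ha, Ring.inverse_mul_cancel _ hg, E.map_one, sub_self]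
  have key := hfree.apply_alternating_resolvent (hmem S v (hfree.1 0) hv1)
    (hmem D w (hfree.1 1) hw1) (hEz _ hgdef.symm) (hEz _ hGS) hpq
  have hsum : ι (w + η g) - S - D = (ι w - D) + (ι v - S) - Ring.inverse (ι g) := by
    rw [hιg, hvdef, map_add, map_add]; abel
  rw [hsum, inverse_add_sub_inverse hw hvS (hg.map ι) rfl rfl (isUnit_one_sub_of_norm_lt_one hpq),
    E.map_incl_mul, key, mul_one]

/-- Subordination for large arguments. All smallness conditions hold eventually because every
family involved behaves like `z` or like `z⁻¹`, up to a factor which tends to `1`. -/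
lemma eventually_subordination (hS : IsCentredSemicircular E η S) (hfree : Free E S D) (β : B) :
    ∀ᶠ z in cobounded ℂ, E (Ring.inverse (ι (β + z • 1) - S - D)) =
      E (Ring.inverse (ι (subordination E η S D (β + z • 1)) - D)) := by
  have hη : Continuous η := map_continuous η
  have hne := eventually_ne_zero_cobounded
  have hb : Tendsto (fun z : ℂ => z⁻¹ • (β + z • (1 : B))) (cobounded ℂ) (𝓝 1) := by
    have h1 : Tendsto (fun z : ℂ => z⁻¹ • z • (1 : B)) (cobounded ℂ) (𝓝 1) := by
      refine tendsto_const_nhds.congr' ?_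
      filter_upwards [hne] with z hz
      rw [smul_smul, inv_mul_cancel₀ hz, one_smul]
    have := tendsto_inv_smul_add h1 (tendsto_const_nhds (x := β))
    simpa only [add_comm] using this
  have hη0 : ∀ {a : ℂ → B}, Tendsto a (cobounded ℂ) (𝓝 0) →
      Tendsto (fun z => η (a z)) (cobounded ℂ) (𝓝 0) := fun h => by
    simpa [Function.comp_def] using (hη.tendsto 0).comp h
  have hA := resolvent_tendsto (ι := ι) (S + D) hb
  have hR := tendsto_smul_inverse_of_inv_smul hA
  have hηG := hη0 (tendsto_zero_of_tendsto_smul (E.tendsto_smul hR))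
  set w : ℂ → B := fun z => β + z • 1 - η (E (Ring.inverse (ι (β + z • 1) - (S + D)))) with hw
  have hwt : Tendsto (fun z => z⁻¹ • w z) (cobounded ℂ) (𝓝 1) := by
    simpa [hw, sub_eq_add_neg] using tendsto_inv_smul_add hb hηG.neg
  have hW := resolvent_tendsto (ι := ι) D hwt
  have hRD := tendsto_smul_inverse_of_inv_smul hW
  set g : ℂ → B := fun z => E (Ring.inverse (ι (w z) - D)) with hg
  have hgt : Tendsto (fun z => z • g z) (cobounded ℂ) (𝓝 1) := E.tendsto_smul hRD
  have hg0 := tendsto_zero_of_tendsto_smul hgt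
  have hgu := eventually_isUnit_of_tendsto_smul hne hgt
  have hgi := tendsto_smul_inverse hne hgt
  set v : ℂ → B := fun z => Ring.inverse (g z) + η (g z) with hv
  have hvt : Tendsto (fun z => z⁻¹ • v z) (cobounded ℂ) (𝓝 1) :=
    tendsto_inv_smul_add hgi (hη0 hg0)
  have hVS := resolvent_tendsto (ι := ι) S hvt
  have hRS := tendsto_smul_inverse_of_inv_smul hVS
  have hGS0 := tendsto_zero_of_tendsto_smul (E.tendsto_smul hRS)
  have hvi0 := tendsto_zero_of_tendsto_smul (tendsto_smul_inverse_of_inv_smul hvt)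
  have hb't : Tendsto (fun z => z⁻¹ • (w z + η (g z))) (cobounded ℂ) (𝓝 1) :=
    tendsto_inv_smul_add hwt (hη0 hg0)
  have hA' := resolvent_tendsto (ι := ι) (S + D) hb't
  have hR0 := tendsto_zero_of_tendsto_smul hR
  have hR'0 := tendsto_zero_of_tendsto_smul (tendsto_smul_inverse_of_inv_smul hA')
  have hι : Continuous ι := map_continuous ι
  have hp : ∀ {a : ℂ → M}, Tendsto (fun z => z • a z) (cobounded ℂ) (𝓝 1) →
      Tendsto (fun z => Ring.inverse (ι (g z)) * a z - 1) (cobounded ℂ) (𝓝 0) := by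
    intro a ha
    have h1 := (((hι.tendsto 1).comp hgi).mul ha).sub_const 1
    simp only [map_one, mul_one, sub_self] at h1
    refine h1.congr' ?_
    filter_upwards [hne, hgu] with z hz hu
    rw [← map_ringInverse ι hu]
    simp [smul_smul, hz]
  have hpq : Tendsto (fun z => ‖(Ring.inverse (ι (g z)) * Ring.inverse (ι (w z) - D) - 1) *
      (Ring.inverse (ι (g z)) * Ring.inverse (ι (v z) - S) - 1)‖) (cobounded ℂ) (𝓝 0) := by
    simpa using ((hp hRD).mul (hp hRS)).norm
  have hone : ∀ {a : ℂ → M}, Tendsto (fun z => z⁻¹ • a z) (cobounded ℂ) (𝓝 1) →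
      ∀ᶠ z in cobounded ℂ, ‖1 - z⁻¹ • a z‖ < 1 := by
    intro a ha
    have h1 := (ha.const_sub 1).norm
    rw [sub_self, norm_zero] at h1
    exact h1.eventually_lt_const one_pos
  have hSh : Tendsto (fun z => ‖S * ι (Ring.inverse (v z))‖) (cobounded ℂ) (𝓝 0) := by
    have := (((hι.tendsto 0).comp hvi0).const_mul S).norm
    simpa using this
  have hsm : Tendsto (fun z => ‖Ring.inverse (v z)‖ *
      (‖positiveCLM η‖ * (‖E (Ring.inverse (ι (v z) - S))‖ + ‖g z‖))) (cobounded ℂ) (𝓝 0) := by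
    simpa using hvi0.norm.mul ((hGS0.norm.add hg0.norm).const_mul ‖positiveCLM η‖)
  have hlip : Tendsto (fun z => ‖positiveCLM η‖ * (‖positiveCLM E‖ *
      (‖Ring.inverse (ι (β + z • 1) - (S + D))‖ *
        ‖Ring.inverse (ι (w z + η (g z)) - (S + D))‖))) (cobounded ℂ) (𝓝 0) := by
    simpa using ((hR0.norm.mul hR'0.norm).const_mul ‖positiveCLM E‖).const_mul ‖positiveCLM η‖
  filter_upwards [hne, hgu, eventually_isUnit_of_inv_smul hW, hone hW,
    eventually_isUnit_of_inv_smul hvt, eventually_isUnit_of_inv_smul hVS, hone hVS,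
    hSh.eventually_lt_const one_pos, hsm.eventually_lt_const one_pos,
    hpq.eventually_lt_const one_pos, hlip.eventually_lt_const one_pos,
    eventually_isUnit_of_inv_smul hA, eventually_isUnit_of_inv_smul hA']
    with z hz h1 h2 h3 h4 h5 h6 h7 h8 h9 h10 h11 h12
  have hG' := apply_resolvent_add hS hfree hz rfl h1 h2 h3 rfl h4 h5 h6 h7 h8 h9
  rw [sub_sub] at hG'
  -- `β + z` and `w + η(g)` have the same image `w` under the subordination function, which is
  -- injective for large arguments because the Cauchy transform has a small Lipschitz constant.
  have heq : β + z • 1 = w z + η (g z) := by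
    rw [← sub_eq_zero]
    refine eq_zero_of_norm_le_mul h10 ?_
    set b₁ := β + z • (1 : B) with hb₁
    set b₂ := w z + η (g z) with hb₂
    have e1 : b₁ - b₂ = η (E (Ring.inverse (ι b₁ - (S + D)) * ι (b₂ - b₁) *
        Ring.inverse (ι b₂ - (S + D)))) := by
      have e2 := ringInverse_sub h11 h12
      rw [sub_sub_sub_cancel_right, ← map_sub] at e2
      have e3 : b₂ = b₁ - η (E (Ring.inverse (ι b₁ - (S + D)))) +
          η (E (Ring.inverse (ι (w z) - D))) := rfl
      rw [← e2, map_sub, map_sub, hG', e3]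
      abel
    have hηn : ∀ x, ‖η x‖ ≤ ‖positiveCLM η‖ * ‖x‖ := (positiveCLM η).le_opNorm
    have hEn : ∀ x, ‖E x‖ ≤ ‖positiveCLM E‖ * ‖x‖ := (positiveCLM E).le_opNorm
    calc ‖b₁ - b₂‖ = _ := by rw [e1]
      _ ≤ ‖positiveCLM η‖ * (‖positiveCLM E‖ * ((‖Ring.inverse (ι b₁ - (S + D))‖ * ‖b₁ - b₂‖) *
        ‖Ring.inverse (ι b₂ - (S + D))‖)) := by
        refine (hηn _).trans (mul_le_mul_of_nonneg_left ((hEn _).trans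
          (mul_le_mul_of_nonneg_left ?_ (norm_nonneg _))) (norm_nonneg _))
        refine (norm_mul_le _ _).trans (mul_le_mul_of_nonneg_right ?_ (norm_nonneg _))
        refine (norm_mul_le _ _).trans (mul_le_mul_of_nonneg_left ?_ (norm_nonneg _))
        exact (NonUnitalStarAlgHom.norm_apply_le ι _).trans (norm_sub_rev _ _).le
      _ = _ := by ring
  have hsub : subordination E η S D (β + z • 1) = w z := by simp only [subordination, hw, sub_sub]
  rw [hsub, sub_sub, heq, hG']

end Subordination

/-! ### Subordination on the half-plane and the contracted positive element -/

section HalfPlane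

variable {B M : Type*} [CStarAlgebra B] [PartialOrder B] [StarOrderedRing B]
  [CStarAlgebra M] [PartialOrder M] [StarOrderedRing M]
  {ι : B →⋆ₐ[ℂ] M} {E : CondExp ι} {η : CompletelyPositiveMap B B} {S D X : M}

lemma imaginaryPart_incl_sub {B M : Type*} [CStarAlgebra B] [CStarAlgebra M] (ι : B →⋆ₐ[ℂ] M)
    {X : M} (hX : IsSelfAdjoint X) (b : B) :
    (imaginaryPart (ι b - X) : M) = ι (imaginaryPart b : B) := by
  rw [map_imaginaryPart ι b, map_sub, hX.imaginaryPart, sub_zero]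

lemma star_mem_upperHalfPlane {b : B} (hb : -b ∈ upperHalfPlane B) :
    star b ∈ upperHalfPlane B := by
  change IsStrictlyPositive (imaginaryPart (star b) : B)
  rw [imaginaryPart_star]
  have h : IsStrictlyPositive (imaginaryPart (-b) : B) := hb
  simpa using h

lemma isStrictlyPositive_imaginaryPart_incl_sub (ι : B →⋆ₐ[ℂ] M) (hX : IsSelfAdjoint X) {b : B}
    (hb : b ∈ upperHalfPlane B) : IsStrictlyPositive (imaginaryPart (ι b - X) : M) := by
  rw [imaginaryPart_incl_sub ι hX]
  exact isStrictlyPositive_incl ι hb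

lemma isUnit_incl_sub (ι : B →⋆ₐ[ℂ] M) (hX : IsSelfAdjoint X) {b : B}
    (hb : b ∈ upperHalfPlane B) : IsUnit (ι b - X) :=
  isUnit_of_isStrictlyPositive_imaginaryPart (isStrictlyPositive_imaginaryPart_incl_sub ι hX hb)

lemma isUnit_incl_sub_of_mem_or (ι : B →⋆ₐ[ℂ] M) (hX : IsSelfAdjoint X) {b : B}
    (hb : b ∈ upperHalfPlane B ∨ -b ∈ upperHalfPlane B) : IsUnit (ι b - X) := by
  rcases hb with hb | hb
  · exact isUnit_incl_sub ι hX hb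
  · have := (isUnit_incl_sub ι hX (star_mem_upperHalfPlane hb)).star
    rwa [star_sub, map_star, star_star, hX.star_eq] at this

lemma isStrictlyPositive_neg_imaginaryPart_resolvent (E : CondExp ι) (hX : IsSelfAdjoint X) {b : B}
    (hb : b ∈ upperHalfPlane B) :
    IsStrictlyPositive (-(imaginaryPart (E (Ring.inverse (ι b - X))) : B)) := by
  rw [← map_imaginaryPart E, ← map_neg]
  exact E.isStrictlyPositive (isStrictlyPositive_neg_imaginaryPart_inverse
    (isStrictlyPositive_imaginaryPart_incl_sub ι hX hb))

lemma imaginaryPart_subordination {M : Type*} [CStarAlgebra M] [PartialOrder M]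
    {ι : B →⋆ₐ[ℂ] M} {E : CondExp ι} {S D : M} (b : B) :
    (imaginaryPart (subordination E η S D b) : B) = (imaginaryPart b : B) +
      η (-(imaginaryPart (E (Ring.inverse (ι b - S - D))) : B)) := by
  rw [subordination, map_sub, map_neg, map_imaginaryPart η]
  push_cast
  abel

lemma subordination_mem_upperHalfPlane (hS : IsSelfAdjoint S) (hD : IsSelfAdjoint D) {b : B}
    (hb : b ∈ upperHalfPlane B) : subordination E η S D b ∈ upperHalfPlane B := by
  change IsStrictlyPositive (imaginaryPart (subordination E η S D b) : B)
  rw [imaginaryPart_subordination, sub_sub]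
  exact IsStrictlyPositive.add_nonneg hb (map_nonneg η
    (isStrictlyPositive_neg_imaginaryPart_resolvent E (hS.add hD) hb).nonneg)

/-- Subordination `E[(b - S - D)⁻¹] = E[(ω(b) - D)⁻¹]` on the upper half-plane: both sides are
analytic along `z ↦ β + z`, and they agree for large `z`. -/
theorem subordination_eq (hS : IsCentredSemicircular E η S) (hD : IsSelfAdjoint D)
    (hfree : Free E S D) {β : B} (hβ : β ∈ upperHalfPlane B) :
    E (Ring.inverse (ι β - S - D)) = E (Ring.inverse (ι (subordination E η S D β) - D)) := by
  obtain ⟨δ, hδ, hδβ⟩ := exists_smul_one_le hβ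
  set U : Set ℂ := {z | -δ < z.im} with hU
  have hUo : IsOpen U := isOpen_lt continuous_const Complex.continuous_im
  have hmem : ∀ z ∈ U, β + z • (1 : B) ∈ upperHalfPlane B := by
    intro z hz
    refine isStrictlyPositive_of_smul_one_le (δ := δ + z.im)
      (by have : -δ < z.im := hz; linarith) ?_
    have : (imaginaryPart (β + z • (1 : B)) : B) = (imaginaryPart β : B) + z.im • (1 : B) := by
      rw [map_add, imaginaryPart_smul]
      simp
    rw [this, add_smul]
    gcongr
  have hSD := hS.1.add hD
  have hb : Differentiable ℂ fun z : ℂ => β + z • (1 : B) := by fun_prop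
  have hR : ∀ (X : M) (b : ℂ → B) (z : ℂ), DifferentiableAt ℂ b z → IsUnit (ι (b z) - X) →
      DifferentiableAt ℂ (fun z => E (Ring.inverse (ι (b z) - X))) z := by
    intro X b z hb hu
    have h1 : DifferentiableAt ℂ (fun z => ι (b z) - X) z :=
      ((positiveCLM ι).differentiableAt.comp z hb).sub_const X
    exact (positiveCLM E).differentiableAt.comp z
      (DifferentiableAt.fun_comp' (g := Ring.inverse) z (differentiableAt_inverse hu) h1)
  have hf : ∀ z ∈ U, DifferentiableAt ℂ (fun z => E (Ring.inverse (ι (β + z • 1) - (S + D)))) z :=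
    fun z hz => hR _ _ z (hb z) (isUnit_incl_sub ι hSD (hmem z hz))
  have hω : ∀ z ∈ U, DifferentiableAt ℂ (fun z => subordination E η S D (β + z • 1)) z := by
    intro z hz
    have := (hb z).fun_sub ((positiveCLM η).differentiableAt.fun_comp' z (hf z hz))
    simpa only [subordination, sub_sub] using! this
  have hg : ∀ z ∈ U, DifferentiableAt ℂ
      (fun z => E (Ring.inverse (ι (subordination E η S D (β + z • 1)) - D))) z :=
    fun z hz => hR _ _ z (hω z hz)
      (isUnit_incl_sub ι hD (subordination_mem_upperHalfPlane hS.1 hD (hmem z hz)))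
  obtain ⟨r, -, hr⟩ := hasBasis_cobounded_norm.eventually_iff.1
    (eventually_subordination hS hfree β)
  -- The two functions agree near a point high up on the imaginary axis.
  set z₀ : ℂ := (|r| + 1 : ℝ) * Complex.I with hz₀
  have hz₀U : z₀ ∈ U := by
    simp only [hU, hz₀, Set.mem_ofPred_eq, Complex.im_ofReal_mul, Complex.I_im]
    have := abs_nonneg r
    linarith
  have hz₀r : r < ‖z₀‖ := by
    rw [hz₀, norm_mul, Complex.norm_I, mul_one, Complex.norm_real, Real.norm_eq_abs]
    have := le_abs_self r
    have := le_abs_self (|r| + 1)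
    linarith
  have hev : (fun z => E (Ring.inverse (ι (β + z • 1) - (S + D)))) =ᶠ[𝓝 z₀]
      (fun z => E (Ring.inverse (ι (subordination E η S D (β + z • 1)) - D))) := by
    filter_upwards [(isOpen_lt continuous_const continuous_norm).mem_nhds hz₀r] with z hz
    simpa only [sub_sub] using hr (Set.mem_ofPred.2 (le_of_lt hz))
  have hfa := DifferentiableOn.analyticOnNhd (fun z hz => (hf z hz).differentiableWithinAt) hUo
  have hga := DifferentiableOn.analyticOnNhd (fun z hz => (hg z hz).differentiableWithinAt) hUo
  have h0 : (0 : ℂ) ∈ U := by simpa [hU] using hδ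
  have := hfa.eqOn_of_preconnected_of_eventuallyEq hga
    (convex_halfSpace_im_gt (-δ)).isPreconnected hz₀U hev h0
  simpa [sub_sub] using this

lemma exists_smul_le {A : Type*} [CStarAlgebra A] [PartialOrder A] [StarOrderedRing A] {p c : A}
    (hp : 0 ≤ p) (hc : IsStrictlyPositive c) : ∃ θ : ℝ, 0 < θ ∧ θ < 1 ∧ θ • p ≤ c := by
  obtain ⟨δ, hδ, h⟩ := exists_smul_one_le hc
  have hn := norm_nonneg p
  have hpos : 0 < ‖p‖ + 1 + δ := by positivity
  refine ⟨δ / (‖p‖ + 1 + δ), by positivity, by rw [div_lt_one hpos]; linarith, ?_⟩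
  have h1 : p ≤ (‖p‖ + 1 + δ) • (1 : A) := le_smul_one_of_norm_le hp.isSelfAdjoint (by linarith)
  refine (smul_le_smul_of_nonneg_left h1 (by positivity)).trans ?_
  rwa [smul_smul, div_mul_cancel₀ _ hpos.ne']

lemma subordination_star (hS : IsSelfAdjoint S) (hD : IsSelfAdjoint D) (b : B) :
    subordination E η S D (star b) = star (subordination E η S D b) := by
  have : ι (star b) - S - D = star (ι b - S - D) := by
    rw [star_sub, star_sub, hS.star_eq, hD.star_eq, map_star]
  rw [subordination, this, Ring.inverse_star, map_star E, map_star η, subordination, star_sub]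

lemma subordination_mem_or (hS : IsSelfAdjoint S) (hD : IsSelfAdjoint D) {b : B}
    (hb : b ∈ upperHalfPlane B ∨ -b ∈ upperHalfPlane B) :
    subordination E η S D b ∈ upperHalfPlane B ∨ -subordination E η S D b ∈ upperHalfPlane B := by
  refine hb.imp (subordination_mem_upperHalfPlane hS hD) fun h => ?_
  have h1 : IsStrictlyPositive (imaginaryPart (subordination E η S D (star b)) : B) :=
    subordination_mem_upperHalfPlane hS hD (star_mem_upperHalfPlane h)
  rw [subordination_star hS hD, imaginaryPart_star] at h1
  change IsStrictlyPositive (imaginaryPart (-subordination E η S D b) : B)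
  simpa using h1

/-- Taking imaginary parts in `G = E[(ω - D)⁻¹]`, where `Im ω = Im β + η(-Im G)`, shows that
`p = -Im G` satisfies `E[R η(p) R⋆] = p - E[R (Im β) R⋆]`, and the subtracted term is bounded below
by a multiple of `p`. The same holds with `R⋆` on the left; the two bounds serve the left and the
right factor of the transfer operator. -/
lemma exists_contraction_of_mem (hS : IsCentredSemicircular E η S) (hD : IsSelfAdjoint D)
    (hfree : Free E S D) {β : B} (hβ : β ∈ upperHalfPlane B) {R : M}
    (hR : R = Ring.inverse (ι (subordination E η S D β) - D)) :
    ∃ p : B, IsStrictlyPositive p ∧ ∃ r : ℝ, 0 < r ∧ r < 1 ∧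
      E (R * ι (η p) * star R) ≤ r • p ∧ E (star R * ι (η p) * R) ≤ r • p := by
  set w := subordination E η S D β with hw
  have hwm : w ∈ upperHalfPlane B := subordination_mem_upperHalfPlane hS.1 hD hβ
  have hu := isUnit_incl_sub ι hD hwm
  have hRu : IsUnit R := hR ▸ hu.ringInverse
  set p : B := -(imaginaryPart (E R) : B) with hp
  have hpp : IsStrictlyPositive p := by
    rw [hp, hR]; exact isStrictlyPositive_neg_imaginaryPart_resolvent E hD hwm
  have hwp : (imaginaryPart w : B) = (imaginaryPart β : B) + η p := by
    rw [hw, imaginaryPart_subordination, subordination_eq hS hD hfree hβ, hp, hR]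
  have hpE : p = E (-(imaginaryPart R : M)) := by rw [hp, map_neg, map_imaginaryPart E]
  have h1 : p = E (R * ι (imaginaryPart β : B) * star R) + E (R * ι (η p) * star R) := by
    conv_lhs => rw [hpE, hR, imaginaryPart_inverse hu, ← hR, imaginaryPart_incl_sub ι hD, hwp]
    rw [← map_add E, ← add_mul, ← mul_add, ← map_add ι]
  have h2 : p = E (star R * ι (imaginaryPart β : B) * R) + E (star R * ι (η p) * R) := by
    conv_lhs => rw [hpE, hR, imaginaryPart_inverse' hu, ← hR, imaginaryPart_incl_sub ι hD, hwp]
    rw [← map_add E, ← add_mul, ← mul_add, ← map_add ι]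
  have hιβ := isStrictlyPositive_incl ι hβ
  obtain ⟨θ₁, h₁, h₁', hθ₁⟩ := exists_smul_le hpp.nonneg
    (E.isStrictlyPositive ((hRu.isStrictlyPositive_star_right_conjugate_iff).2 hιβ))
  obtain ⟨θ₂, h₂, h₂', hθ₂⟩ := exists_smul_le hpp.nonneg
    (E.isStrictlyPositive ((hRu.isStrictlyPositive_star_left_conjugate_iff).2 hιβ))
  have hle : ∀ {θ : ℝ} {c d : B}, θ • p ≤ c → p = c + d → min θ₁ θ₂ ≤ θ →
      d ≤ (1 - min θ₁ θ₂) • p := by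
    intro θ c d hc hd hθ
    rw [sub_smul, one_smul, le_sub_iff_add_le, add_comm]
    calc _ ≤ c + d := by
          gcongr
          exact (smul_le_smul_of_nonneg_right hθ hpp.nonneg).trans hc
      _ = p := hd.symm
  exact ⟨p, hpp, 1 - min θ₁ θ₂, by linarith [min_le_left θ₁ θ₂], by linarith [lt_min h₁ h₂],
    hle hθ₁ h1 (min_le_left _ _), hle hθ₂ h2 (min_le_right _ _)⟩

/-- The lower half-plane is reduced to the upper one by adjoints: `ω(β⋆) = ω(β)⋆` exchanges `R` and
`R⋆`, and the two bounds with them. -/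
lemma exists_contraction (hS : IsCentredSemicircular E η S) (hD : IsSelfAdjoint D)
    (hfree : Free E S D) {β : B} (hβ : β ∈ upperHalfPlane B ∨ -β ∈ upperHalfPlane B) {R : M}
    (hR : R = Ring.inverse (ι (subordination E η S D β) - D)) :
    ∃ p : B, IsStrictlyPositive p ∧ ∃ r : ℝ, 0 < r ∧ r < 1 ∧
      E (R * ι (η p) * star R) ≤ r • p ∧ E (star R * ι (η p) * R) ≤ r • p := by
  rcases hβ with hβ | hβ
  · exact exists_contraction_of_mem hS hD hfree hβ hR
  · have hst : star R = Ring.inverse (ι (subordination E η S D (star β)) - D) := by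
      rw [subordination_star hS.1 hD, map_star, hR, ← Ring.inverse_star, star_sub, hD.star_eq]
    obtain ⟨p, hp, r, h0, h1, h2, h3⟩ :=
      exists_contraction_of_mem hS hD hfree (star_mem_upperHalfPlane hβ) hst
    rw [star_star] at h2 h3
    exact ⟨p, hp, r, h0, h1, h3, h2⟩

end HalfPlane

/-! ### Positive two-by-two matrices and the spectral radius -/

section FormNonneg

variable {A : Type*} [CStarAlgebra A] [PartialOrder A]

/-- Positivity of the `2 × 2` matrix with rows `(a, v)` and `(v⋆, c)` over a C⋆-algebra, expressed
through its `A`-valued quadratic form. -/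
def FormNonneg (a v c : A) : Prop :=
  ∀ x y : A, 0 ≤ star x * a * x + star x * v * y + star y * star v * x + star y * c * y

variable {a v c a' c' : A} [StarOrderedRing A]

lemma FormNonneg.mono (h : FormNonneg a v c) (ha : a ≤ a') (hc : c ≤ c') :
    FormNonneg a' v c' := fun x y =>
  (h x y).trans (by gcongr <;> exact star_left_conjugate_le_conjugate ‹_› _)

lemma FormNonneg.norm_le (h : FormNonneg a v c) {K : ℝ} (hK : 0 < K) (ha : a ≤ K • (1 : A))
    (hc : c ≤ K • (1 : A)) : ‖v‖ ≤ K := by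
  -- Evaluating the form at `(v, -K)` gives `K v⋆v ≤ K³`.
  have h1 := (h.mono ha hc) v (-(K • (1 : A)))
  have h2 : star v * v ≤ (K ^ 2) • (1 : A) := by
    have h3 : star v * (K • (1 : A)) * v + star v * v * -(K • (1 : A)) +
        star (-(K • (1 : A))) * star v * v + star (-(K • (1 : A))) * (K • (1 : A)) *
          -(K • (1 : A)) = K • ((K ^ 2) • (1 : A) - star v * v) := by
      simp [smul_smul, smul_sub, pow_succ]
      abel
    rw [h3] at h1
    have h4 := smul_nonneg (inv_nonneg.2 hK.le) h1
    rw [smul_smul, inv_mul_cancel₀ hK.ne', one_smul] at h4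
    exact sub_nonneg.1 h4
  have h5 := norm_le_of_le_smul_one (star_mul_self_nonneg v) (by positivity) h2
  rw [CStarRing.norm_star_mul_self] at h5
  nlinarith [norm_nonneg v]

lemma formNonneg_of_norm_le {δ : ℝ} (hδ : 0 < δ) (ha : δ • (1 : A) ≤ a) (hc : δ • (1 : A) ≤ c)
    (hv : ‖v‖ ≤ δ) : FormNonneg a v c := by
  refine FormNonneg.mono (a := δ • 1) (c := δ • 1) (fun x y => ?_) ha hc
  have h1 : star v * v ≤ (δ ^ 2) • (1 : A) := by
    refine le_smul_one_of_norm_le (IsSelfAdjoint.star_mul_self v) ?_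
    rw [CStarRing.norm_star_mul_self]
    nlinarith [norm_nonneg v]
  -- Complete the square in `δ x⋆x + x⋆vy + y⋆v⋆x + δ y⋆y`.
  have h2 : 0 ≤ δ⁻¹ • (star (δ • x + v * y) * (δ • x + v * y) +
      star y * ((δ ^ 2) • (1 : A) - star v * v) * y) :=
    smul_nonneg (inv_nonneg.2 hδ.le) (add_nonneg (star_mul_self_nonneg _)
      (star_left_conjugate_nonneg (sub_nonneg.2 h1) y))
  convert h2 using 1
  have hδ' := hδ.ne'
  simp only [star_add, star_smul, star_mul, star_trivial, mul_add, add_mul, mul_sub, sub_mul,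
    smul_add, smul_sub, smul_mul_assoc, mul_smul_comm, smul_smul, mul_one, mul_assoc]
  have e1 : δ⁻¹ * (δ * δ) = δ := by field_simp
  have e2 : δ⁻¹ * δ ^ 2 = δ := by field_simp
  have e3 : δ⁻¹ * δ = 1 := by field_simp
  simp only [e1, e2, e3, one_smul]
  abel

open CStarMatrix in
/-- A Schur complement factorisation: with `d = a - v c⁻¹ v⋆ ≥ 0`, the matrix is `N⋆ N` for the
lower triangular `N` with rows `(√d, 0)` and `(c^(-1/2) v⋆, c^(1/2))`. -/
lemma FormNonneg.cstarMatrix_nonneg (h : FormNonneg a v c) (hc : IsStrictlyPositive c) :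
    0 ≤ (ofMatrix !![a, v; star v, c] : CStarMatrix (Fin 2) (Fin 2) A) := by
  have hsa : star (CFC.sqrt c) = CFC.sqrt c := (CFC.sqrt_nonneg c).star_eq
  have hss : CFC.sqrt c * CFC.sqrt c = c := CFC.sqrt_mul_sqrt_self _ hc.nonneg
  obtain ⟨u, hu⟩ := hc.isUnit_cfcSqrt
  rw [← hu] at hsa hss
  have hui : star (↑u⁻¹ : A) = ↑u⁻¹ := by
    have : star u = u := Units.ext hsa
    rw [← Units.coe_star, star_inv, this]
  have hd : 0 ≤ a - v * ↑u⁻¹ * ↑u⁻¹ * star v := by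
    have := h 1 (-(↑u⁻¹ * ↑u⁻¹ * star v))
    rw [← hss] at this
    simpa [mul_assoc, hui] using this
  set e := CFC.sqrt (a - v * ↑u⁻¹ * ↑u⁻¹ * star v) with he
  have hes : star e = e := (CFC.sqrt_nonneg _).star_eq
  have hee : e * e = a - v * ↑u⁻¹ * ↑u⁻¹ * star v := CFC.sqrt_mul_sqrt_self _ hd
  have hN : (ofMatrix !![a, v; star v, c] : CStarMatrix (Fin 2) (Fin 2) A) =
      star (ofMatrix !![e, 0; ↑u⁻¹ * star v, ↑u]) * ofMatrix !![e, 0; ↑u⁻¹ * star v, ↑u] := by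
    ext i j
    fin_cases i <;> fin_cases j <;>
      simp [CStarMatrix.mul_apply, Fin.sum_univ_two, star_apply, hes, hee, hui, hsa, hss, mul_assoc]
  rw [hN]
  exact star_mul_self_nonneg _

open CStarMatrix in
/-- A positive matrix is a sum of matrices `N⋆ N`, whose quadratic forms, with the entries mapped
by a star homomorphism, are sums of squares. -/
lemma FormNonneg.map {A' : Type*} [CStarAlgebra A'] [PartialOrder A'] [StarOrderedRing A']
    (f : A →⋆ₐ[ℂ] A')
    (h : 0 ≤ (ofMatrix !![a, v; star v, c] : CStarMatrix (Fin 2) (Fin 2) A)) :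
    FormNonneg (f a) (f v) (f c) := by
  have key : ∀ N : CStarMatrix (Fin 2) (Fin 2) A, 0 ≤ N → ∀ x y : A',
      0 ≤ star x * f (N 0 0) * x + star x * f (N 0 1) * y + star y * f (N 1 0) * x +
        star y * f (N 1 1) * y := by
    intro N hN
    rw [StarOrderedRing.nonneg_iff] at hN
    induction hN using AddSubmonoid.closure_induction with
    | mem N hN =>
      obtain ⟨N, rfl⟩ := hN
      intro x y
      have := add_nonneg (star_mul_self_nonneg (f (N 0 0) * x + f (N 0 1) * y))
        (star_mul_self_nonneg (f (N 1 0) * x + f (N 1 1) * y))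
      convert this using 1
      simp only [CStarMatrix.mul_apply, Fin.sum_univ_two, star_apply, map_add, map_mul, map_star,
        star_add, star_mul, mul_add, add_mul, mul_assoc]
      abel
    | zero => simp
    | add N₁ N₂ _ _ h₁ h₂ =>
      intro x y
      convert add_nonneg (h₁ x y) (h₂ x y) using 1
      simp only [CStarMatrix.add_apply, map_add, mul_add, add_mul]
      abel
  intro x y
  simpa [map_star] using key _ h x y

end FormNonneg

section Transfer

variable {B M : Type*} [CStarAlgebra B] [PartialOrder B] [StarOrderedRing B]
  [CStarAlgebra M] [PartialOrder M] [StarOrderedRing M]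
  {ι : B →⋆ₐ[ℂ] M}

/-- Positivity of `2 × 2` matrices is preserved when the completely positive `η`, the
compression by `diag(R₁, R₂⋆)` and the conditional expectation are applied in turn. -/
lemma FormNonneg.transfer (E : CondExp ι) (η : CompletelyPositiveMap B B) {a v c : B}
    (h : FormNonneg a v c) (hc : IsStrictlyPositive c) (R₁ R₂ : M) :
    FormNonneg (E (R₁ * ι (η a) * star R₁)) (E (R₁ * ι (η v) * R₂))
      (E (star R₂ * ι (η c) * R₂)) := by
  have h1 := η.map_cstarMatrix_nonneg' 2 _ (h.cstarMatrix_nonneg hc)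
  have h2 : (CStarMatrix.map (CStarMatrix.ofMatrix !![a, v; star v, c]) η.toLinearMap :
      CStarMatrix (Fin 2) (Fin 2) B) =
      CStarMatrix.ofMatrix !![η a, η v; star (η v), η c] := by
    ext i j
    rw [← map_star η]
    fin_cases i <;> fin_cases j <;> rfl
  rw [h2] at h1
  intro x y
  have h3 := map_nonneg E (FormNonneg.map ι h1 (star R₁ * ι x) (R₂ * ι y))
  convert h3 using 1
  simp only [map_add, ← map_star E, ← E.map_incl_mul_incl]
  simp only [star_mul, star_star, map_star, mul_assoc]

/-- If `p₁`, `p₂` are contracted by the two diagonal operators `v ↦ E[R₁ η(v) R₁⋆]` and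
`v ↦ E[R₂⋆ η(v) R₂]`, then powers of the off-diagonal operator `v ↦ E[R₁ η(v) R₂]` decay
geometrically, because `(p₁, v, p₂)` stays positive up to the contraction factor. -/
lemma exists_norm_pow_le (E : CondExp ι) (η : CompletelyPositiveMap B B) {R₁ R₂ : M}
    (T : B →L[ℂ] B) (hT : ∀ v, T v = E (R₁ * ι (η v) * R₂)) {p₁ p₂ : B}
    (hp₁ : IsStrictlyPositive p₁) (hp₂ : IsStrictlyPositive p₂) {r : ℝ} (hr : 0 < r)
    (h₁ : E (R₁ * ι (η p₁) * star R₁) ≤ r • p₁) (h₂ : E (star R₂ * ι (η p₂) * R₂) ≤ r • p₂) :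
    ∃ C : ℝ, ∀ n : ℕ, ‖T ^ n‖ ≤ C * r ^ n := by
  have hη : Continuous η := map_continuous η
  have hE : Continuous E := map_continuous E
  have hι : Continuous ι := map_continuous ι
  have hform : ∀ v : B, FormNonneg p₁ v p₂ →
      ∀ n : ℕ, FormNonneg (r ^ n • p₁) ((T ^ n) v) (r ^ n • p₂) := by
    intro v hv n
    induction n with
    | zero => simpa using hv
    | succ n ih =>
      have h3 := ih.transfer E η (hp₂.smul (pow_pos hr n)) R₁ R₂
      rw [← hT, map_real_smul η hη, map_real_smul ι hι, map_real_smul η hη, map_real_smul ι hι,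
        mul_smul_comm, smul_mul_assoc, map_real_smul E hE, mul_smul_comm, smul_mul_assoc,
        map_real_smul E hE] at h3
      have hTn : (T ^ (n + 1)) v = T ((T ^ n) v) := by rw [pow_succ' T]; rfl
      rw [hTn, pow_succ, mul_smul, mul_smul]
      exact h3.mono (smul_le_smul_of_nonneg_left h₁ (by positivity))
        (smul_le_smul_of_nonneg_left h₂ (by positivity))
  obtain ⟨δ₁, hδ₁, hle₁⟩ := exists_smul_one_le hp₁
  obtain ⟨δ₂, hδ₂, hle₂⟩ := exists_smul_one_le hp₂
  set δ := min δ₁ δ₂ with hδdef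
  have hδ : 0 < δ := lt_min hδ₁ hδ₂
  have hd₁ : δ • (1 : B) ≤ p₁ :=
    (smul_le_smul_of_nonneg_right (min_le_left _ _) zero_le_one).trans hle₁
  have hd₂ : δ • (1 : B) ≤ p₂ :=
    (smul_le_smul_of_nonneg_right (min_le_right _ _) zero_le_one).trans hle₂
  set K := ‖p₁‖ + ‖p₂‖ + 1 with hK
  have hn₁ := norm_nonneg p₁
  have hn₂ := norm_nonneg p₂
  have hKpos : 0 < K := by positivity
  have hk₁ : p₁ ≤ K • (1 : B) := le_smul_one_of_norm_le hp₁.isSelfAdjoint (by linarith)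
  have hk₂ : p₂ ≤ K • (1 : B) := le_smul_one_of_norm_le hp₂.isSelfAdjoint (by linarith)
  have hball : ∀ v : B, ‖v‖ ≤ δ → ∀ n : ℕ, ‖(T ^ n) v‖ ≤ K * r ^ n := by
    intro v hv n
    refine (hform v (formNonneg_of_norm_le hδ hd₁ hd₂ hv) n).norm_le (by positivity) ?_ ?_
    all_goals
      rw [mul_comm, mul_smul]
      exact smul_le_smul_of_nonneg_left ‹_› (by positivity)
  refine ⟨K / δ, fun n => ContinuousLinearMap.opNorm_le_bound _ (by positivity) fun v => ?_⟩
  rcases eq_or_ne v 0 with rfl | hv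
  · simp
  · have hvpos : 0 < ‖v‖ := norm_pos_iff.2 hv
    have h3 := hball (((δ / ‖v‖ : ℝ) : ℂ) • v) (by
      rw [norm_smul, Complex.norm_real, Real.norm_of_nonneg (by positivity),
        div_mul_cancel₀ _ hvpos.ne']) n
    rw [map_smul, norm_smul, Complex.norm_real, Real.norm_of_nonneg (by positivity)] at h3
    calc ‖(T ^ n) v‖ = (‖v‖ / δ) * (δ / ‖v‖ * ‖(T ^ n) v‖) := by field_simp
      _ ≤ (‖v‖ / δ) * (K * r ^ n) := by gcongr
      _ = _ := by ring

end Transfer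

lemma spectralRadius_lt_one_of_norm_pow_le {V : Type*} [NormedAddCommGroup V] [NormedSpace ℂ V]
    [CompleteSpace V] {T : V →L[ℂ] V} {C r : ℝ} (hr0 : 0 ≤ r) (hr : r < 1)
    (h : ∀ n : ℕ, ‖T ^ n‖ ≤ C * r ^ n) : spectralRadius ℂ T < 1 := by
  have hlim : Filter.Tendsto (fun n => C * r ^ (n + 1)) Filter.atTop (nhds 0) := by
    simpa using ((tendsto_pow_atTop_nhds_zero_of_lt_one hr0 hr).comp
      (Filter.tendsto_add_atTop_nat 1)).const_mul C
  obtain ⟨n, hn⟩ := (hlim.eventually_lt_const one_pos).exists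
  have hn' : ‖T ^ (n + 1)‖₊ < 1 := (h (n + 1)).trans_lt hn
  have h1 : ‖(1 : V →L[ℂ] V)‖₊ ≤ 1 := ContinuousLinearMap.norm_id_le
  have hpos : (0 : ℝ) < 1 / (n + 1) := by positivity
  calc spectralRadius ℂ T ≤ _ := spectrum.spectralRadius_le_pow_nnnorm_pow_one_div ℂ T n
    _ ≤ (‖T ^ (n + 1)‖₊ : ENNReal) ^ (1 / (n + 1) : ℝ) * 1 := by
      gcongr
      exact ENNReal.rpow_le_one (by exact_mod_cast h1) hpos.le
    _ < 1 := by
      rw [mul_one]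
      exact ENNReal.rpow_lt_one (by exact_mod_cast hn') hpos

lemma spectrum_subset_ball_of_spectralRadius_lt_one {R : Type*} [NormedRing R] [NormedAlgebra ℂ R]
    {a : R} (h : spectralRadius ℂ a < 1) : spectrum ℂ a ⊆ Metric.ball 0 1 := by
  intro z hz
  have h1 : (‖z‖₊ : ENNReal) < 1 :=
    (le_iSup₂ (f := fun (k : ℂ) (_ : k ∈ spectrum ℂ a) => (‖k‖₊ : ENNReal)) z hz).trans_lt h
  have h2 : ‖z‖₊ < 1 := by exact_mod_cast h1
  exact mem_ball_zero_iff.2 h2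

end OpValuedFree
open OpValuedFree in
theorem proposition5p3 {B M : Type*}
    [CStarAlgebra B] [PartialOrder B] [StarOrderedRing B]
    [CStarAlgebra M] [PartialOrder M] [StarOrderedRing M]
    (ι : B →⋆ₐ[ℂ] M) (E : CondExp ι) (η : CompletelyPositiveMap B B) (S D : M)
    (hS : IsCentredSemicircular E η S) (hD : IsSelfAdjoint D) (hfree : Free E S D)
    (β₁ β₂ : B)
    (hβ : (β₁ ∈ upperHalfPlane B ∧ β₂ ∈ upperHalfPlane B) ∨
      (-β₁ ∈ upperHalfPlane B ∧ -β₂ ∈ upperHalfPlane B) ∨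
      (β₁ ∈ upperHalfPlane B ∧ -β₂ ∈ upperHalfPlane B) ∨
      (-β₁ ∈ upperHalfPlane B ∧ β₂ ∈ upperHalfPlane B)) :
    (∀ β ∈ ({β₁, β₂} : Set B),
      IsUnit (ι β - S - D) ∧ IsUnit (ι (subordination E η S D β) - D)) ∧
    spectrum ℂ (transferOperator E η D (subordination E η S D β₁) (subordination E η S D β₂)) ⊆
      Metric.ball 0 1 ∧
    spectralRadius ℂ
      (transferOperator E η D (subordination E η S D β₁) (subordination E η S D β₂)) < 1 := by
  have h₁ : β₁ ∈ upperHalfPlane B ∨ -β₁ ∈ upperHalfPlane B := by tauto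
  have h₂ : β₂ ∈ upperHalfPlane B ∨ -β₂ ∈ upperHalfPlane B := by tauto
  have hunit : ∀ β : B, β ∈ upperHalfPlane B ∨ -β ∈ upperHalfPlane B →
      IsUnit (ι β - S - D) ∧ IsUnit (ι (subordination E η S D β) - D) := fun β hβ =>
    ⟨by rw [sub_sub]; exact isUnit_incl_sub_of_mem_or ι (hS.1.add hD) hβ,
      isUnit_incl_sub_of_mem_or ι hD (subordination_mem_or hS.1 hD hβ)⟩
  have hrad : spectralRadius ℂ
      (transferOperator E η D (subordination E η S D β₁) (subordination E η S D β₂)) < 1 := by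
    obtain ⟨p₁, hp₁, r₁, hr₁, hr₁', hc₁, -⟩ := exists_contraction hS hD hfree h₁ rfl
    obtain ⟨p₂, hp₂, r₂, hr₂, hr₂', -, hc₂⟩ := exists_contraction hS hD hfree h₂ rfl
    obtain ⟨C, hC⟩ := exists_norm_pow_le E η
      (transferOperator E η D (subordination E η S D β₁) (subordination E η S D β₂))
      (fun v => rfl) hp₁ hp₂ (lt_max_of_lt_left hr₁)
      (hc₁.trans (smul_le_smul_of_nonneg_right (le_max_left r₁ r₂) hp₁.nonneg))
      (hc₂.trans (smul_le_smul_of_nonneg_right (le_max_right r₁ r₂) hp₂.nonneg))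
    exact spectralRadius_lt_one_of_norm_pow_le (hr₁.le.trans (le_max_left _ _))
      (max_lt hr₁' hr₂') hC
  refine ⟨fun β hβ => ?_, spectrum_subset_ball_of_spectralRadius_lt_one hrad, hrad⟩
  rcases hβ with rfl | rfl
  · exact hunit _ h₁
  · exact hunit _ h₂
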